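/- Let $L$ be a countable first-order language with a distinguished binary relation symbol $<$, and let $T$ be a complete $L$-theory such that $<$ is a strict linear order in every model of $T$ and such that $T$ has Skolem functions (for every formula $\varphi(\bar x,y)$ there is a term $\tau(\bar x)$ with $T\vdash \forall\bar x\,(\exists y\,\varphi(\bar x,y)\rightarrow\varphi(\bar x,\tau(\bar x)))$). Suppose that $T$ satisfies the inaccessibility scheme: for every $L$-formula $\varphi(\bar x,\bar t)$, with $\bar x,\bar t$ finite tuples of variables, $$T\vdash \forall z_0\,\exists z_1>z_0\,\forall \bar y_0\,\exists \bar y_1<z_1\,\forall \bar t<z_0\,\bigl(\varphi(\bar y_0,\bar t)\leftrightarrow\varphi(\bar y_1,\bar t)\bigr),$$ where $\bar t<z$ means that every entry of $\bar t$ is less than $z$. For a regular cardinal $\kappa$ and a model $M$ of $T$, write $\mathrm{cof}(M)=\kappa$ if $\kappa$ is the least cardinal that is the length of a strictly increasing cofinal sequence of elements of $M$. Let $M$ be a model of $T$ and $\kappa$ a regular cardinal such that $\mathrm{cof}(M)=\kappa$ and $M$ is $\kappa$-saturated (every set of formulas in one variable, with parameters from a subset of $M$ of cardinality less than $\kappa$,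 that is finitely satisfiable in $M$ is realized in $M$). Then for every regular cardinal $\lambda\le\kappa$, $M$ has a proper elementary end extension $N$ with $|N|=|M|$ and $\mathrm{cof}(N)=\lambda$; that is, $N$ is an elementary extension of $M$ with $N\neq M$, and every $b\in N$ with $b<a$ for some $a\in M$ belongs to $M$. -/

import Mathlib

open FirstOrder Cardinal

universe u v w

namespace EndExt

open FirstOrder.Language

variable {L : FirstOrder.Language.{u, v}}

/-- The formula `s < t`, where `<` is the distinguished binary relation symbol `lt`. -/
def ltF (lt : L.Relations 2) {α : Type*} (s t : L.Term α) : L.Formula α :=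
  lt.formula₂ s t

/-- The interpretation of the symbol `lt` in a structure. -/
def Lt (lt : L.Relations 2) {M : Type*} [L.Structure M] (x y : M) : Prop :=
  Structure.RelMap lt ![x, y]

theorem realize_ltF (lt : L.Relations 2) {α M : Type*} [L.Structure M] (s t : L.Term α)
    (x : α → M) : (ltF lt s t).Realize x ↔ Lt lt (s.realize x) (t.realize x) :=
  Formula.realize_rel₂

/-- The axioms saying that `lt` is a strict linear order. -/
def strictLinearOrderTheory (lt : L.Relations 2) : L.Theory :=
  { lt.irreflexive, lt.transitive,
    Formula.iAlls (Fin 2) (α := Empty)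
      (ltF lt (Term.var (Sum.inr 0)) (Term.var (Sum.inr 1)) ⊔
        ((Term.var (Sum.inr 0)).equal (Term.var (Sum.inr 1)) ⊔
          ltF lt (Term.var (Sum.inr 1)) (Term.var (Sum.inr 0)))) }

/-- The models of these axioms are the structures in which `lt` is a strict linear order. -/
theorem model_strictLinearOrderTheory (lt : L.Relations 2) (M : Type*) [L.Structure M] :
    M ⊨ strictLinearOrderTheory lt ↔
      (∀ x : M, ¬ Lt lt x x) ∧ (∀ x y z : M, Lt lt x y → Lt lt y z → Lt lt x z) ∧
        ∀ x y : M, Lt lt x y ∨ x = y ∨ Lt lt y x := by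
  rw [strictLinearOrderTheory, Theory.model_insert_iff, Theory.model_insert_iff,
    Theory.model_singleton_iff, Relations.realize_irreflexive, Relations.realize_transitive]
  refine and_congr ⟨fun h => h.irrefl, fun h => ⟨h⟩⟩
    (and_congr ⟨fun h => h.trans, fun h => ⟨h⟩⟩ ?_)
  simp only [Sentence.Realize, Formula.realize_iAlls, Formula.realize_sup, realize_ltF,
    Formula.realize_equal, Term.realize_var, Sum.elim_inr]
  exact ⟨fun h x y => h ![x, y], fun h i => h (i 0) (i 1)⟩

/-- `T` has Skolem functions: for every formula `φ(x̄, y)` there is a term `τ(x̄)` such that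
`T` proves `(∃ y, φ(x̄, y)) → φ(x̄, τ(x̄))`. -/
def HasSkolemFunctions (T : L.Theory) : Prop :=
  ∀ (n : ℕ) (φ : L.Formula (Fin n ⊕ Unit)), ∃ τ : L.Term (Fin n),
    T ⊨ᵇ (φ.iExs Unit).imp (BoundedFormula.subst φ (Sum.elim Term.var fun _ => τ))

/-- The formula `E_φ(ȳ₀, ȳ₁; z₀)`, i.e. `∀ t̄ < z₀, (φ(ȳ₀, t̄) ↔ φ(ȳ₁, t̄))`. Its free variables are
the three summands `ȳ₀`, `ȳ₁`, `z₀`; a tuple is `< z₀` when all its entries are. -/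
noncomputable def formulaE (lt : L.Relations 2) {k m : ℕ} (φ : L.Formula (Fin k ⊕ Fin m)) :
    L.Formula (Fin k ⊕ Fin k ⊕ Unit) :=
  Formula.iAlls (Fin m) <|
    (Formula.iInf fun j : Fin m =>
      ltF lt (Term.var (Sum.inr j)) (Term.var (Sum.inl (Sum.inr (Sum.inr ()))))).imp
    ((φ.relabel (Sum.elim (fun i => Sum.inl (Sum.inl i)) Sum.inr)).iff
      (φ.relabel (Sum.elim (fun i => Sum.inl (Sum.inr (Sum.inl i))) Sum.inr)))

/-- The instance of the inaccessibility scheme for `φ(x̄, t̄)`: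
`∀ z₀, ∃ z₁ > z₀, ∀ ȳ₀, ∃ ȳ₁ < z₁, E_φ(ȳ₀, ȳ₁; z₀)`. -/
noncomputable def inaccessibilitySentence (lt : L.Relations 2) {k m : ℕ}
    (φ : L.Formula (Fin k ⊕ Fin m)) : L.Sentence :=
  Formula.iAlls Unit <| Formula.iExs Unit <|
    ltF lt (Term.var (Sum.inl (Sum.inr ()))) (Term.var (Sum.inr ())) ⊓
    (Formula.iAlls (Fin k) <| Formula.iExs (Fin k) <|
      (Formula.iInf fun i : Fin k =>
        ltF lt (Term.var (Sum.inr i)) (Term.var (Sum.inl (Sum.inl (Sum.inr ()))))) ⊓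
      (formulaE lt φ).relabel (Sum.elim (fun i => Sum.inl (Sum.inr i))
        (Sum.elim Sum.inr fun _ => Sum.inl (Sum.inl (Sum.inl (Sum.inr ()))))))

/-- What an instance of the scheme says in a structure. -/
theorem realize_inaccessibilitySentence (lt : L.Relations 2) {k m : ℕ}
    (φ : L.Formula (Fin k ⊕ Fin m)) (M : Type*) [L.Structure M] :
    M ⊨ inaccessibilitySentence lt φ ↔
      ∀ z₀ : M, ∃ z₁ : M, Lt lt z₀ z₁ ∧ ∀ y₀ : Fin k → M, ∃ y₁ : Fin k → M,
        (∀ i, Lt lt (y₁ i) z₁) ∧ ∀ t : Fin m → M, (∀ j, Lt lt (t j) z₀) →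
          (φ.Realize (Sum.elim y₀ t) ↔ φ.Realize (Sum.elim y₁ t)) := by
  have h1 : ∀ (f : (Fin k ⊕ Fin k ⊕ Unit) ⊕ Fin m → M),
      f ∘ Sum.elim (fun i => Sum.inl (Sum.inl i)) Sum.inr =
        Sum.elim (fun i => f (Sum.inl (Sum.inl i))) (fun j => f (Sum.inr j)) := by
    intro f; ext (_ | _) <;> rfl
  have h2 : ∀ (f : (Fin k ⊕ Fin k ⊕ Unit) ⊕ Fin m → M),
      f ∘ Sum.elim (fun i => Sum.inl (Sum.inr (Sum.inl i))) Sum.inr =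
        Sum.elim (fun i => f (Sum.inl (Sum.inr (Sum.inl i)))) (fun j => f (Sum.inr j)) := by
    intro f; ext (_ | _) <;> rfl
  have hU : ∀ P : (Unit → M) → Prop, (∀ i, P i) ↔ ∀ x : M, P fun _ => x :=
    fun P => ⟨fun h x => h _, fun h i => h (i ())⟩
  have hE : ∀ P : (Unit → M) → Prop, (∃ i, P i) ↔ ∃ x : M, P fun _ => x :=
    fun P => ⟨fun ⟨i, h⟩ => ⟨i (), h⟩, fun ⟨x, h⟩ => ⟨_, h⟩⟩
  simp only [inaccessibilitySentence, formulaE, Sentence.Realize, Formula.realize_iAlls,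
    Formula.realize_iExs, hU, hE]
  simp [realize_ltF, h1, h2]

/-- `T` satisfies the inaccessibility scheme. -/
def InaccessibilityScheme (lt : L.Relations 2) (T : L.Theory) : Prop :=
  ∀ (k m : ℕ) (φ : L.Formula (Fin k ⊕ Fin m)), T ⊨ᵇ inaccessibilitySentence lt φ

/-- There is a strictly increasing cofinal sequence of length `κ` (for the strict order `r`). -/
def HasCofinalSeq {M : Type w} (r : M → M → Prop) (κ : Cardinal.{w}) : Prop :=
  ∃ f : Set.Iio κ.ord → M, (∀ i j, i < j → r (f i) (f j)) ∧ ∀ x, ∃ i, x = f i ∨ r x (f i)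

/-- `cof(M) = κ`: the cardinal `κ` is regular and it is the least cardinal that is the length of a
strictly increasing cofinal sequence. -/
def HasCof {M : Type w} (r : M → M → Prop) (κ : Cardinal.{w}) : Prop :=
  κ.IsRegular ∧ IsLeast {μ : Cardinal.{w} | HasCofinalSeq r μ} κ

variable (L) in
/-- `M` is `κ`-saturated: for every `A ⊆ M` of cardinality less than `κ`, every set of formulas
`φ(x)` with parameters from `A` that is finitely satisfiable in `M` is realized in `M`.
The parameters are the variables indexed by `A`, each of them evaluated at itself. -/
def IsSaturated (M : Type w) [L.Structure M] (κ : Cardinal.{w}) : Prop :=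
  ∀ A : Set M, #A < κ → ∀ p : Set (L.Formula (A ⊕ Unit)),
    (∀ q : Finset (L.Formula (A ⊕ Unit)), ↑q ⊆ p →
      ∃ x : M, ∀ φ ∈ q, φ.Realize (Sum.elim (fun a : A => (a : M)) fun _ => x)) →
    ∃ x : M, ∀ φ ∈ p, φ.Realize (Sum.elim (fun a : A => (a : M)) fun _ => x)

/-- The elementary embedding `f` makes `N` a proper end extension of `M`: some element of `N` is
not in (the image of) `M`, and every element of `N` below an element of `M` is in `M`. -/
def IsProperEndExtension (lt : L.Relations 2) {M N : Type*} [L.Structure M] [L.Structure N]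
    (f : M ↪ₑ[L] N) : Prop :=
  (∃ b : N, b ∉ Set.range f) ∧ ∀ (a : M) (b : N), Lt lt b (f a) → b ∈ Set.range f

end EndExt

/-! `N` is an iterated end extension of `M`, obtained by adding at once an increasing sequence of
new elements of length `μ`, each lying above everything generated by `M` and the earlier ones. It is
cut out of an ultrapower over `I → M`, with `I` of order type `μ`, as the hull of the constants and
of the coordinate functions; Skolem functions make the hull elementary.

The ultrafilter must satisfy `Decides`: below any fixed bound on the parameters, a formula in
finitely many coordinates has the same truth values throughout one of its sets, and this set is
`Big`, with larger indices quantified further inside. Uniformity makes a term bounded by an element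
of `M` eventually constant, so the extension is an end extension. Bigness puts a coordinate above
every term in earlier coordinates, so the coordinates are cofinal.

Deciding a formula below a bound means choosing one class of the relation E_φ. By the scheme a
bounded set of tuples represents all classes, and `exists_big` (a pigeonhole resting on the
regularity statement `collection`) finds a class that keeps a big set big. Cofinality `κ` leaves at
most `κ` choices to make; at each stage fewer than `κ` have been made, so `κ`-saturation yields a
class compatible with all of them (`exists_coherent`). -/

namespace EndExt

open FirstOrder.Language Function

variable {L : FirstOrder.Language.{u, v}} {M : Type w} [L.Structure M]

/-! ### Predicates definable over a set of parameters -/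

variable (L) in
/-- The predicate `P` is defined by a formula with parameters from `A`. -/
def Dfn (A : Set M) {α : Type*} (P : (α → M) → Prop) : Prop :=
  ∃ φ : L.Formula (A ⊕ α), ∀ x, φ.Realize (Sum.elim (fun a : A => (a : M)) x) ↔ P x

namespace Dfn

variable {A B : Set M} {α β : Type*} {P Q : (α → M) → Prop}

theorem congr (h : Dfn L A P) (hPQ : ∀ x, P x ↔ Q x) : Dfn L A Q :=
  let ⟨φ, hφ⟩ := h
  ⟨φ, fun x => (hφ x).trans (hPQ x)⟩

theorem of_formula (A : Set M) (φ : L.Formula α) : Dfn L A (φ.Realize : (α → M) → Prop) :=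
  ⟨φ.relabel Sum.inr, fun x => by rw [Formula.realize_relabel, Sum.elim_comp_inr]⟩

theorem comp (h : Dfn L A P) (f : (β → M) → α → M)
    (hf : ∀ i, (∃ j, ∀ x, f x i = x j) ∨ ∃ a ∈ A, ∀ x, f x i = a) :
    Dfn L A fun x => P (f x) := by
  obtain ⟨φ, hφ⟩ := h
  have : ∀ i, ∃ g : A ⊕ β, ∀ x, f x i = Sum.elim (fun a : A => (a : M)) x g := by
    intro i
    rcases hf i with ⟨j, hj⟩ | ⟨a, ha, h⟩
    · exact ⟨Sum.inr j, hj⟩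
    · exact ⟨Sum.inl ⟨a, ha⟩, h⟩
  choose g hg using this
  refine ⟨φ.relabel (Sum.elim Sum.inl g), fun x => ?_⟩
  rw [Formula.realize_relabel]
  refine Iff.trans (iff_of_eq (congrArg _ ?_)) (hφ (f x))
  ext (i | i)
  · rfl
  · exact (hg i x).symm

theorem mono (h : Dfn L A P) (hAB : A ⊆ B) : Dfn L B P := by
  obtain ⟨φ, hφ⟩ := h
  refine ⟨φ.relabel (Sum.map (Set.inclusion hAB) id), fun x => ?_⟩
  rw [Formula.realize_relabel, ← hφ]
  refine iff_of_eq (congrArg _ ?_)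
  ext (i | i) <;> rfl

theorem not (h : Dfn L A P) : Dfn L A fun x => ¬ P x :=
  let ⟨φ, hφ⟩ := h
  ⟨φ.not, fun x => by rw [Formula.realize_not, hφ]⟩

theorem and (h : Dfn L A P) (h' : Dfn L A Q) : Dfn L A fun x => P x ∧ Q x :=
  let ⟨φ, hφ⟩ := h
  let ⟨ψ, hψ⟩ := h'
  ⟨φ ⊓ ψ, fun x => by rw [Formula.realize_inf, hφ, hψ]⟩

theorem imp (h : Dfn L A P) (h' : Dfn L A Q) : Dfn L A fun x => P x → Q x :=
  (h.and h'.not).not.congr fun x => by tauto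

theorem iff (h : Dfn L A P) (h' : Dfn L A Q) : Dfn L A fun x => (P x ↔ Q x) :=
  ((h.imp h').and (h'.imp h)).congr fun x => by tauto

theorem true (A : Set M) (α : Type*) : Dfn L A fun _ : α → M => True :=
  ⟨⊤, fun _ => by simp⟩

theorem finset_ball {ι : Type*} {P : ι → (α → M) → Prop} (s : Finset ι)
    (h : ∀ i ∈ s, Dfn L A (P i)) : Dfn L A fun x => ∀ i ∈ s, P i x := by
  classical
  induction s using Finset.induction_on with
  | empty => exact (Dfn.true A α).congr (by simp)
  | insert i s _ ih =>
    refine ((h i (Finset.mem_insert_self i s)).and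
      (ih fun j hj => h j (Finset.mem_insert_of_mem hj))).congr fun x => ?_
    simp

theorem fintype_all {ι : Type*} [Finite ι] {P : ι → (α → M) → Prop}
    (h : ∀ i, Dfn L A (P i)) : Dfn L A fun x => ∀ i, P i x := by
  cases nonempty_fintype ι
  exact (finset_ball Finset.univ fun i _ => h i).congr (by simp)

theorem ex [Finite β] {P : (α → M) → (β → M) → Prop}
    (h : Dfn L A fun w : α ⊕ β → M => P (w ∘ Sum.inl) (w ∘ Sum.inr)) :
    Dfn L A fun x => ∃ y, P x y := by
  obtain ⟨φ, hφ⟩ := h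
  refine ⟨(φ.relabel (Equiv.sumAssoc A α β).symm).iExs β, fun x => ?_⟩
  rw [Formula.realize_iExs]
  refine exists_congr fun y => ?_
  rw [Formula.realize_relabel]
  refine Iff.trans (iff_of_eq (congrArg _ ?_)) (hφ (Sum.elim x y))
  ext (i | i | i) <;> rfl

theorem all [Finite β] {P : (α → M) → (β → M) → Prop}
    (h : Dfn L A fun w : α ⊕ β → M => P (w ∘ Sum.inl) (w ∘ Sum.inr)) :
    Dfn L A fun x => ∀ y, P x y :=
  (ex (P := fun x y => ¬ P x y) h.not).not.congr fun _ => by simp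

theorem ex_elem {P : (α → M) → M → Prop}
    (h : Dfn L A fun w : α ⊕ Unit → M => P (w ∘ Sum.inl) (w (Sum.inr ()))) :
    Dfn L A fun x => ∃ y, P x y :=
  (ex (β := Unit) (P := fun x y => P x (y ())) h).congr fun _ =>
    ⟨fun ⟨_, hy⟩ => ⟨_, hy⟩, fun ⟨y, hy⟩ => ⟨fun _ => y, hy⟩⟩

theorem all_elem {P : (α → M) → M → Prop}
    (h : Dfn L A fun w : α ⊕ Unit → M => P (w ∘ Sum.inl) (w (Sum.inr ()))) :
    Dfn L A fun x => ∀ y, P x y :=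
  (ex_elem (P := fun x y => ¬ P x y) h.not).not.congr fun _ => by simp

theorem lt (s : L.Relations 2) (A : Set M) (i j : α) :
    Dfn L A fun x : α → M => Lt s (x i) (x j) :=
  (of_formula A (ltF s (Term.var i) (Term.var j))).congr fun x => realize_ltF s _ _ x

/-- Only finitely many parameters occur in a definition. -/
theorem exists_finset (h : Dfn L A P) : ∃ A₀ : Finset M, Dfn L (A₀ : Set M) P := by
  classical
  obtain ⟨φ, hφ⟩ := h
  have hm : ∀ a : A, Sum.inl a ∈ φ.freeVarFinset →
      (a : M) ∈ (φ.freeVarFinset.preimage Sum.inl Sum.inl_injective.injOn).image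
        (fun a : A => (a : M)) := fun a ha =>
    Finset.mem_image_of_mem _ (Finset.mem_preimage.2 ha)
  refine ⟨(φ.freeVarFinset.preimage Sum.inl Sum.inl_injective.injOn).image
    (fun a : A => (a : M)), φ.restrictFreeVar fun y =>
      match y with
      | ⟨Sum.inl a, ha⟩ => Sum.inl ⟨a, hm a ha⟩
      | ⟨Sum.inr i, _⟩ => Sum.inr i, fun x => ?_⟩
  rw [← hφ]
  refine BoundedFormula.realize_restrictFreeVar _ ?_
  rintro ⟨a | i, h⟩ <;> rfl

end Dfn

/-! ### Saturation for finite tuples -/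

theorem IsSaturated.exists_elem {κ : Cardinal.{w}} (h : IsSaturated L M κ) {A : Set M}
    (hA : #A < κ) {ι : Type*} {P : ι → M → Prop} (hP : ∀ i, Dfn L A fun x : Unit → M => P i (x ()))
    (hfin : ∀ s : Finset ι, ∃ x, ∀ i ∈ s, P i x) : ∃ x, ∀ i, P i x := by
  classical
  choose φ hφ using hP
  obtain ⟨x, hx⟩ := h A hA (Set.range φ) fun q hq => by
    have : ∀ ψ : q, ∃ i, φ i = ψ := fun ψ => hq ψ.2
    choose g hg using this
    obtain ⟨x, hx⟩ := hfin (Finset.univ.image g)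
    refine ⟨x, fun ψ hψ => ?_⟩
    have := hx (g ⟨ψ, hψ⟩) (Finset.mem_image_of_mem _ (Finset.mem_univ _))
    have := (hφ _ fun _ => x).2 this
    rwa [hg] at this
  exact ⟨x, fun i => (hφ i _).1 (hx _ ⟨i, rfl⟩)⟩

theorem IsSaturated.exists_fin {κ : Cardinal.{w}} (h : IsSaturated L M κ) (hκ : ℵ₀ ≤ κ) {n : ℕ}
    {A : Set M} (hA : #A < κ) {ι : Type*} {P : ι → (Fin n → M) → Prop} (hP : ∀ i, Dfn L A (P i))
    (hfin : ∀ s : Finset ι, ∃ x, ∀ i ∈ s, P i x) : ∃ x, ∀ i, P i x := by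
  classical
  induction n generalizing A ι with
  | zero =>
    refine ⟨Fin.elim0, fun i => ?_⟩
    obtain ⟨x, hx⟩ := hfin {i}
    rw [Subsingleton.elim Fin.elim0 x]
    exact hx i (Finset.mem_singleton_self i)
  | succ n ih =>
    -- The first entry is chosen so that every finite set of conditions remains solvable in the
    -- other entries; it then joins the parameters.
    obtain ⟨a, ha⟩ := h.exists_elem hA (ι := Finset ι)
      (P := fun s a => ∃ y : Fin n → M, ∀ i ∈ s, P i (Fin.cons a y)) (fun s => by
        refine Dfn.ex (P := fun (x : Unit → M) (y : Fin n → M) =>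
          ∀ i ∈ s, P i (Fin.cons (x ()) y)) (Dfn.finset_ball s fun i _ => ?_)
        refine (hP i).comp (fun w : Unit ⊕ Fin n → M =>
          (Fin.cons (w (Sum.inl ())) (w ∘ Sum.inr) : Fin (n + 1) → M)) fun j => Or.inl ?_
        induction j using Fin.cases with
        | zero => exact ⟨Sum.inl (), fun x => rfl⟩
        | succ j => exact ⟨Sum.inr j, fun x => rfl⟩) fun S => by
      obtain ⟨x, hx⟩ := hfin (S.biUnion id)
      refine ⟨x 0, fun s hs => ⟨Fin.tail x, fun i hi => ?_⟩⟩
      rw [Fin.cons_self_tail]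
      exact hx i (Finset.mem_biUnion.2 ⟨s, hs, hi⟩)
    have hA' : #(insert a A : Set M) < κ :=
      (mk_insert_le).trans_lt (add_lt_of_lt hκ hA (one_lt_aleph0.trans_le hκ))
    obtain ⟨y, hy⟩ := ih hA' (P := fun i (y : Fin n → M) => P i (Fin.cons a y)) (fun i => by
      refine ((hP i).mono (Set.subset_insert a A)).comp (fun y : Fin n → M =>
        (Fin.cons a y : Fin (n + 1) → M)) fun j => ?_
      induction j using Fin.cases with
      | zero => exact Or.inr ⟨a, Set.mem_insert a A, fun x => rfl⟩
      | succ j => exact Or.inl ⟨j, fun x => rfl⟩) ha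
    exact ⟨_, hy⟩

theorem IsSaturated.exists_tuple {κ : Cardinal.{w}} (h : IsSaturated L M κ) (hκ : ℵ₀ ≤ κ)
    {K : Type*} [Finite K] {A : Set M} (hA : #A < κ) {ι : Type*} {P : ι → (K → M) → Prop}
    (hP : ∀ i, Dfn L A (P i)) (hfin : ∀ s : Finset ι, ∃ x, ∀ i ∈ s, P i x) :
    ∃ x, ∀ i, P i x := by
  obtain ⟨n, ⟨e⟩⟩ := Finite.exists_equiv_fin K
  obtain ⟨x, hx⟩ := h.exists_fin hκ hA (P := fun i (x : Fin n → M) => P i (x ∘ e))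
    (fun i => (hP i).comp (fun x : Fin n → M => x ∘ e) fun j => Or.inl ⟨e j, fun _ => rfl⟩)
    fun s => by
      obtain ⟨x, hx⟩ := hfin s
      exact ⟨x ∘ e.symm, by simpa [Function.comp_assoc] using hx⟩
  exact ⟨_, hx⟩

/-! ### The inaccessibility scheme in a structure -/

/-- In `M` the symbol `s` is a strict linear order without maximum, and the inaccessibility scheme
holds. -/
structure InaccessibleOrder (s : L.Relations 2) (M : Type w) [L.Structure M] : Prop where
  irrefl : ∀ x : M, ¬ Lt s x x
  trans : ∀ {x y z : M}, Lt s x y → Lt s y z → Lt s x z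
  total : ∀ x y : M, Lt s x y ∨ x = y ∨ Lt s y x
  exists_gt : ∀ x : M, ∃ y, Lt s x y
  nonempty : Nonempty M
  scheme : ∀ (k m : ℕ) (φ : L.Formula (Fin k ⊕ Fin m)) (z₀ : M), ∃ z₁ : M, Lt s z₀ z₁ ∧
    ∀ y₀ : Fin k → M, ∃ y₁ : Fin k → M, (∀ i, Lt s (y₁ i) z₁) ∧
      ∀ t : Fin m → M, (∀ j, Lt s (t j) z₀) →
        (φ.Realize (Sum.elim y₀ t) ↔ φ.Realize (Sum.elim y₁ t))

namespace InaccessibleOrder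

variable {s : L.Relations 2} (h : InaccessibleOrder s M)
include h

theorem exists_ub_pair (x y : M) : ∃ z, Lt s x z ∧ Lt s y z := by
  rcases h.total x y with hxy | rfl | hxy
  · obtain ⟨z, hz⟩ := h.exists_gt y
    exact ⟨z, h.trans hxy hz, hz⟩
  · obtain ⟨z, hz⟩ := h.exists_gt x
    exact ⟨z, hz, hz⟩
  · obtain ⟨z, hz⟩ := h.exists_gt x
    exact ⟨z, hz, h.trans hxy hz⟩

theorem exists_ub_finset (S : Finset M) : ∃ z, ∀ x ∈ S, Lt s x z := by
  classical
  induction S using Finset.induction_on with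
  | empty => exact ⟨h.nonempty.some, by simp⟩
  | insert a S _ ih =>
    obtain ⟨z, hz⟩ := ih
    obtain ⟨z', h1, h2⟩ := h.exists_ub_pair a z
    refine ⟨z', fun x hx => ?_⟩
    rcases Finset.mem_insert.1 hx with rfl | hx
    · exact h1
    · exact h.trans (hz x hx) h2

theorem scheme_tuple {K P : Type*} [Finite K] [Finite P] (φ : L.Formula (K ⊕ P)) (z₀ : M) :
    ∃ z₁ : M, Lt s z₀ z₁ ∧ ∀ y₀ : K → M, ∃ y₁ : K → M, (∀ i, Lt s (y₁ i) z₁) ∧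
      ∀ t : P → M, (∀ j, Lt s (t j) z₀) →
        (φ.Realize (Sum.elim y₀ t) ↔ φ.Realize (Sum.elim y₁ t)) := by
  obtain ⟨k, ⟨e⟩⟩ := Finite.exists_equiv_fin K
  obtain ⟨m, ⟨f⟩⟩ := Finite.exists_equiv_fin P
  obtain ⟨z₁, hz, H⟩ := h.scheme k m (φ.relabel (Sum.map e f)) z₀
  refine ⟨z₁, hz, fun y₀ => ?_⟩
  obtain ⟨y₁, hy, H⟩ := H (y₀ ∘ e.symm)
  refine ⟨y₁ ∘ e, fun i => hy _, fun t ht => ?_⟩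
  have := H (t ∘ f.symm) fun j => ht _
  rw [Formula.realize_relabel, Formula.realize_relabel] at this
  convert this using 3
  · ext (i | i) <;> simp
  · ext (i | i) <;> simp

/-- Regularity: a definable family of bounded sets indexed by the tuples below `z` is uniformly
bounded. -/
theorem collection {K : Type*} [Finite K] {A : Set M} {R : (K → M) → M → Prop}
    (hR : Dfn L A fun w : K ⊕ Unit → M => R (w ∘ Sum.inl) (w (Sum.inr ()))) (z : M)
    (hb : ∀ y : K → M, (∀ i, Lt s (y i) z) → ∃ m, ∀ x, Lt s m x → ¬ R y x) :
    ∃ m, ∀ y : K → M, (∀ i, Lt s (y i) z) → ∀ x, Lt s m x → ¬ R y x := by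
  classical
  -- The parameters of `R` will be entries of the finite tuple t̄ of the scheme, so they must be
  -- finitely many and lie below `z₀`.
  obtain ⟨A₀, hR⟩ := hR.exists_finset
  obtain ⟨φ, hφ⟩ : Dfn L (A₀ : Set M) fun w : Unit ⊕ K → M =>
      ∀ x, Lt s (w (Sum.inl ())) x → ¬ R (w ∘ Sum.inr) x := by
    refine Dfn.all_elem (P := fun (w : Unit ⊕ K → M) x =>
      Lt s (w (Sum.inl ())) x → ¬ R (w ∘ Sum.inr) x) ((Dfn.lt s _ _ _).imp ?_)
    refine (hR.comp (fun w : (Unit ⊕ K) ⊕ Unit → M =>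
      Sum.elim (fun k => w (Sum.inl (Sum.inr k))) fun _ => w (Sum.inr ())) ?_).not
    rintro (k | k)
    · exact Or.inl ⟨_, fun _ => rfl⟩
    · exact Or.inl ⟨_, fun _ => rfl⟩
  obtain ⟨z₀, hz₀⟩ := h.exists_ub_finset (insert z A₀)
  -- Here ȳ is the bound `m`, and t̄ consists of `y` and the parameters. Any bound for `R y` can be
  -- replaced by one below `z₁`, so `z₁` bounds the whole family.
  obtain ⟨z₁, -, H⟩ := h.scheme_tuple (K := Unit) (P := K ⊕ (A₀ : Set M))
    (φ.relabel (Sum.elim (fun a => Sum.inr (Sum.inr a))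
      (Sum.elim (fun _ => Sum.inl ()) fun k => Sum.inr (Sum.inl k)))) z₀
  refine ⟨z₁, fun y hy x hx => ?_⟩
  obtain ⟨m, hm⟩ := hb y hy
  obtain ⟨m', hm', H⟩ := H fun _ => m
  have H := H (Sum.elim y fun a => (a : M)) (by
    rintro (k | a)
    · exact h.trans (hy k) (hz₀ z (Finset.mem_insert_self _ _))
    · exact hz₀ a (Finset.mem_insert_of_mem a.2))
  have key : ∀ m : Unit → M,
      ((φ.relabel (Sum.elim (fun a => Sum.inr (Sum.inr a))
      (Sum.elim (fun _ => Sum.inl ()) fun k => Sum.inr (Sum.inl k)))).Realize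
        (Sum.elim m (Sum.elim y fun a : (A₀ : Set M) => (a : M))) ↔
        ∀ x, Lt s (m ()) x → ¬ R y x) := by
    intro m
    have := hφ (Sum.elim m y)
    rw [Formula.realize_relabel]
    refine Iff.trans (iff_of_eq (congrArg _ ?_)) this
    ext (i | i | i) <;> rfl
  rw [key, key] at H
  exact H.1 hm x (h.trans (hm' ()) hx)

end InaccessibleOrder

/-! ### Big predicates -/

section Big

variable {I : Type*} [DecidableEq I]

/-- The predicate `X` holds for unboundedly many values of the last variable of the list `l`, for
unboundedly many values of the last but one, and so on. The innermost quantifier is the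
head of the list. -/
def Big (r : M → M → Prop) : List I → ((I → M) → Prop) → (I → M) → Prop
  | [], X => X
  | i :: l, X => Big r l fun v => ∀ m, ∃ x, r m x ∧ X (update v i x)

namespace Big

variable {r : M → M → Prop} {l : List I} {X Y : (I → M) → Prop} {v : I → M}

theorem mono (hXY : ∀ v, X v → Y v) (hX : Big r l X v) : Big r l Y v := by
  induction l generalizing X Y with
  | nil => exact hXY v hX
  | cons i l ih =>
    refine ih (fun v hv m => ?_) hX
    obtain ⟨x, hx, hX⟩ := hv m
    exact ⟨x, hx, hXY _ hX⟩

theorem of_forall (hr : ∀ x, ∃ y, r x y) (hX : ∀ v, X v) : Big r l X v := by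
  induction l generalizing X with
  | nil => exact hX v
  | cons i l ih => exact ih fun v m => (hr m).imp fun x hx => ⟨hx, hX _⟩

theorem exists_of (hM : Nonempty M) (hX : Big r l X v) : ∃ v, X v := by
  induction l generalizing X with
  | nil => exact ⟨v, hX⟩
  | cons i l ih =>
    obtain ⟨v', hv⟩ := ih hX
    obtain ⟨x, -, hx⟩ := hv hM.some
    exact ⟨_, hx⟩

/-- A quantifier over a variable that `X` ignores can be dropped, because a single witness already
gives `X`. This brings a condition back from a common set of variables to its own. -/
theorem sublist (hM : Nonempty M) {l' : List I} (hl : l'.Sublist l)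
    (hn : l.Nodup) (hX : ∀ i ∈ l, i ∉ l' → ∀ v x, X (update v i x) ↔ X v) (h : Big r l X v) : Big r l' X v := by
  induction hl generalizing X with
  | slnil => exact h
  | @cons l' l i hl ih =>
    have hi : i ∉ l' := fun hi => (List.nodup_cons.1 hn).1 (hl.subset hi)
    refine ih hn.of_cons (fun j hj hj' => hX j (List.mem_cons_of_mem _ hj) hj')
      (h.mono fun v hv => ?_)
    obtain ⟨x, -, hx⟩ := hv hM.some
    exact (hX i List.mem_cons_self hi v x).1 hx
  | @cons_cons l' l i hl ih =>
    refine ih hn.of_cons (fun j hj hj' v y => ?_) h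
    rcases eq_or_ne j i with rfl | hji
    · simp only [update_idem]
    · simp only [update_comm hji]
      refine forall_congr' fun m => exists_congr fun x => and_congr_right fun _ => ?_
      exact hX j (List.mem_cons_of_mem _ hj) (by simp [hji, hj']) _ _

end Big

theorem Dfn.big {s : L.Relations 2} {A : Set M} {γ : Type*} {P : (γ → M) → (I → M) → Prop}
    (hP : Dfn L A fun w : γ ⊕ I → M => P (w ∘ Sum.inl) (w ∘ Sum.inr)) (l : List I) :
    Dfn L A fun w : γ ⊕ I → M => Big (Lt s) l (P (w ∘ Sum.inl)) (w ∘ Sum.inr) := by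
  induction l generalizing P with
  | nil => exact hP
  | cons i l ih =>
    refine ih (P := fun c v => ∀ m, ∃ x, Lt s m x ∧ P c (update v i x)) ?_
    refine Dfn.all_elem (P := fun (w : γ ⊕ I → M) m => ∃ x, Lt s m x ∧
      P (w ∘ Sum.inl) (update (w ∘ Sum.inr) i x)) (Dfn.ex_elem
      (P := fun (w : (γ ⊕ I) ⊕ Unit → M) x => Lt s (w (Sum.inr ())) x ∧
        P ((w ∘ Sum.inl) ∘ Sum.inl) (update ((w ∘ Sum.inl) ∘ Sum.inr) i x))
        ((Dfn.lt s _ _ _).and ?_))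
    refine hP.comp (fun w : ((γ ⊕ I) ⊕ Unit) ⊕ Unit → M =>
      Sum.elim (fun k => w (Sum.inl (Sum.inl (Sum.inl k))))
        (update (fun k => w (Sum.inl (Sum.inl (Sum.inr k)))) i (w (Sum.inr ())))) ?_
    rintro (k | k)
    · exact Or.inl ⟨_, fun _ => rfl⟩
    · rcases eq_or_ne k i with rfl | hk
      · exact Or.inl ⟨Sum.inr (), fun _ => by simp⟩
      · exact Or.inl ⟨Sum.inl (Sum.inl (Sum.inr k)), fun _ => by simp [hk]⟩

/-- A big set which is the union of a definable family indexed by the tuples below `z` has a big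
member of the family. -/
theorem InaccessibleOrder.exists_big {s : L.Relations 2} (h : InaccessibleOrder s M)
    {K : Type*} [Finite K] {R : (K → M) → (I → M) → Prop}
    (hR : Dfn L Set.univ fun w : K ⊕ I → M => R (w ∘ Sum.inl) (w ∘ Sum.inr)) (z : M)
    (l : List I) (v : I → M)
    (hb : Big (Lt s) l (fun v => ∃ y, (∀ i, Lt s (y i) z) ∧ R y v) v) :
    ∃ y, Big (Lt s) l (R y) v := by
  suffices ∃ y, (∀ i, Lt s (y i) z) ∧ Big (Lt s) l (R y) v from this.imp fun _ => And.right
  induction l generalizing R with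
  | nil => exact hb
  | cons i l ih =>
    refine ih (R := fun y v => ∀ m, ∃ x, Lt s m x ∧ R y (update v i x))
      (Dfn.big (l := [i]) hR) (Big.mono (fun v hv => ?_) hb)
    -- If each `y` below `z` had only boundedly many `x`, `collection` would bound them all at once,
    -- against the bigness of the union.
    by_contra! hc
    obtain ⟨m, hm⟩ := h.collection (A := Set.univ) (R := fun y x => R y (update v i x)) (by
      refine hR.comp (fun w : K ⊕ Unit → M =>
        Sum.elim (fun k => w (Sum.inl k)) (update v i (w (Sum.inr ())))) ?_
      rintro (k | k)
      · exact Or.inl ⟨_, fun _ => rfl⟩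
      · rcases eq_or_ne k i with rfl | hk
        · exact Or.inl ⟨Sum.inr (), fun _ => by simp⟩
        · exact Or.inr ⟨v k, trivial, fun _ => by simp [hk]⟩) z hc
    obtain ⟨x, hx, y, hy, hxy⟩ := hv m
    exact hm y hy x hx hxy

end Big

/-! ### Coherent choice of classes -/

/-- The value at `β` is picked by `Classical.epsilon` from the earlier values alone, so the
invariant `G` can be proved by induction after the recursion. -/
theorem exists_wellFounded_rec {B : Type*} [LinearOrder B] [WellFoundedLT B] {C : B → Type*}
    [∀ β, Nonempty (C β)] (G : ∀ β, (∀ γ : Set.Iio β, C γ) → C β → Prop)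
    (step : ∀ β (a : ∀ γ, C γ), (∀ γ < β, G γ (fun δ => a δ) (a γ)) → ∃ y, G β (fun γ => a γ) y) :
    ∃ a : ∀ γ, C γ, ∀ β, G β (fun γ => a γ) (a β) := by
  let a : ∀ γ, C γ := (wellFounded_lt (α := B)).fix fun β prev =>
    Classical.epsilon (G β fun γ => prev γ γ.2)
  have ha : ∀ β, a β = Classical.epsilon (G β fun γ => a γ) := fun β =>
    (wellFounded_lt (α := B)).fix_eq _ β
  refine ⟨a, fun β => ?_⟩
  induction β using WellFoundedLT.induction with
  | ind β ih =>
    have := Classical.epsilon_spec (step β a ih)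
    rwa [← ha] at this

/-- `E β y` is the class of `y` for the `β`-th relation, and `hbdd` says that a bounded set of
tuples represents every class. The classes are chosen by recursion on `β`, keeping all finite
intersections big. -/
theorem exists_coherent {s : L.Relations 2} (h : InaccessibleOrder s M) {κ : Cardinal.{w}}
    (hκ : κ.IsRegular) (hsat : IsSaturated L M κ) {I : Type*} [LinearOrder I]
    {B : Type w} [LinearOrder B] [WellFoundedLT B] (hB : ∀ β : B, #(Set.Iio β) < κ)
    (S : B → Finset I) (E : ∀ β, (S β → M) → (I → M) → Prop)
    (hE : ∀ β y i, i ∉ S β → ∀ v x, E β y (update v i x) ↔ E β y v) (z : B → M)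
    (hdef : ∀ β, Dfn L {z β} fun w : S β ⊕ I → M => E β (w ∘ Sum.inl) (w ∘ Sum.inr))
    (hbdd : ∀ β, ∃ z₁, ∀ v, ∃ y, (∀ i, Lt s (y i) z₁) ∧ E β y v) (m₀ : M) :
    ∃ a : ∀ β, S β → M, ∀ (F : Finset B) (t : Finset I), (∀ β ∈ F, S β ⊆ t) →
      Big (Lt s) (t.sort (· ≥ ·)) (fun v => ∀ β ∈ F, E β (a β) v) fun _ => m₀ := by
  classical
  have : Nonempty M := ⟨m₀⟩
  -- A finite set of conditions is handled by the recursive invariant at its largest index.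
  have of_max : ∀ (a : ∀ β, S β → M) (F : Finset B),
      (∀ γ ∈ F, ∀ (F : Finset (Set.Iio γ)) (t : Finset I), (∀ δ ∈ F, S δ ⊆ t) → S γ ⊆ t →
        Big (Lt s) (t.sort (· ≥ ·)) (fun v => E γ (a γ) v ∧ ∀ δ ∈ F, E δ (a δ) v) fun _ => m₀) →
      ∀ t : Finset I, (∀ γ ∈ F, S γ ⊆ t) →
        Big (Lt s) (t.sort (· ≥ ·)) (fun v => ∀ γ ∈ F, E γ (a γ) v) fun _ => m₀ := by
    intro a F H t ht
    rcases F.eq_empty_or_nonempty with rfl | hne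
    · exact Big.of_forall h.exists_gt (by simp)
    · have hmax := F.max'_mem hne
      refine (H _ hmax (F.subtype (· ∈ Set.Iio (F.max' hne))) t
        (fun δ hδ => ht _ (Finset.mem_subtype.1 hδ)) (ht _ hmax)).mono fun v hv γ hγ => ?_
      rcases (F.le_max' γ hγ).lt_or_eq with hlt | heq
      · exact hv.2 ⟨γ, hlt⟩ (Finset.mem_subtype.2 hγ)
      · rw [heq]
        exact hv.1
  obtain ⟨a, ha⟩ := exists_wellFounded_rec (C := fun β => S β → M)
    (fun β prev y => ∀ (F : Finset (Set.Iio β)) (t : Finset I), (∀ γ ∈ F, S γ ⊆ t) → S β ⊆ t →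
      Big (Lt s) (t.sort (· ≥ ·)) (fun v => E β y v ∧ ∀ γ ∈ F, E γ (prev γ) v) fun _ => m₀) (by
    intro β a ih
    -- All parameters of the type to be realized; regularity of `κ` keeps them fewer than `κ`.
    let A : Set M := {m₀} ∪ {z β} ∪ ⋃ γ : Set.Iio β, ({z γ} ∪ Set.range (a γ))
    have hfin : ∀ F : Set M, F.Finite → #F < κ := fun F hF =>
      (lt_aleph0_iff_set_finite.2 hF).trans_le hκ.aleph0_le
    have hA : #A < κ := by
      refine (mk_union_le _ _).trans_lt (add_lt_of_lt hκ.aleph0_le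
        (hfin _ (Set.toFinite _)) ?_)
      rw [card_iUnion_lt_iff_forall_of_isRegular hκ (hB β)]
      exact fun γ => hfin _ (Set.toFinite _)
    obtain ⟨y, hy⟩ := hsat.exists_tuple hκ.aleph0_le (K := S β) hA
      (ι := {p : Finset (Set.Iio β) × Finset I // (∀ γ ∈ p.1, S γ ⊆ p.2) ∧ S β ⊆ p.2})
      (P := fun p y => Big (Lt s) (p.1.2.sort (· ≥ ·))
        (fun v => E β y v ∧ ∀ γ ∈ p.1.1, E γ (a γ) v) fun _ => m₀) (by
        rintro ⟨⟨F, t⟩, hF, ht⟩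
        have := Dfn.big (s := s) (A := A) (P := fun (y : S β → M) (v : I → M) =>
          E β y v ∧ ∀ γ ∈ F, E γ (a γ) v) (by
            refine ((hdef β).mono ?_).and (Dfn.finset_ball _ fun γ hγ => ?_)
            · simp [A]
            · refine ((hdef γ).mono ?_).comp (fun w : S β ⊕ I → M =>
                Sum.elim (a γ) (w ∘ Sum.inr)) ?_
              · refine Set.Subset.trans ?_ Set.subset_union_right
                exact Set.Subset.trans Set.subset_union_left (Set.subset_iUnion_of_subset γ le_rfl)
              · rintro (i | i)
                · refine Or.inr ⟨a γ i, ?_, fun _ => rfl⟩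
                  exact Or.inr (Set.mem_iUnion.2 ⟨γ, Or.inr ⟨i, rfl⟩⟩)
                · exact Or.inl ⟨_, fun _ => rfl⟩) (t.sort (· ≥ ·))
        refine this.comp (fun y : S β → M => Sum.elim y fun _ => m₀) ?_
        rintro (i | i)
        · exact Or.inl ⟨_, fun _ => rfl⟩
        · exact Or.inr ⟨m₀, by simp [A], fun _ => rfl⟩) (by
      intro T
      -- Finitely many requirements are merged into one, on the union of their conditions and of
      -- their variables.
      let F : Finset (Set.Iio β) := T.biUnion fun p => p.1.1
      let t : Finset I := S β ∪ T.biUnion fun p => p.1.2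
      have h1 := of_max a (F.map (Embedding.subtype _)) (by
        intro γ hγ
        obtain ⟨δ, -, rfl⟩ := Finset.mem_map.1 hγ
        exact ih δ δ.2) t (by
        intro γ hγ
        obtain ⟨δ, hδ, rfl⟩ := Finset.mem_map.1 hγ
        obtain ⟨p, hp, hδ⟩ := Finset.mem_biUnion.1 hδ
        exact (p.2.1 δ hδ).trans ((Finset.subset_biUnion_of_mem (fun p => p.1.2) hp).trans
          Finset.subset_union_right))
      -- The big set given by the earlier choices is covered by the classes of tuples below `z₁`, so
      -- one class meets it in a big set.
      obtain ⟨z₁, hz₁⟩ := hbdd β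
      obtain ⟨y, hy⟩ := h.exists_big (K := S β) (R := fun y v => E β y v ∧
          ∀ γ ∈ F, E γ (a γ) v) (by
        refine ((hdef β).mono (Set.subset_univ _)).and (Dfn.finset_ball _ fun γ hγ => ?_)
        refine ((hdef γ).mono (Set.subset_univ _)).comp (fun w : S β ⊕ I → M =>
                Sum.elim (a γ) (w ∘ Sum.inr)) ?_
        rintro (i | i)
        · exact Or.inr ⟨a γ i, trivial, fun _ => rfl⟩
        · exact Or.inl ⟨_, fun _ => rfl⟩) z₁ (t.sort (· ≥ ·)) (fun _ => m₀)
        (h1.mono fun v hv => by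
          obtain ⟨y, hy, hEy⟩ := hz₁ v
          exact ⟨y, hy, hEy, fun γ hγ => hv γ (Finset.mem_map_of_mem _ hγ)⟩)
      refine ⟨y, fun p hp => ?_⟩
      have hsub : (p.1.2.sort (· ≥ ·)).Sublist (t.sort (· ≥ ·)) :=
        List.sublist_of_subperm_of_sortedGE
          ((Finset.sort_nodup _ _).subperm fun i hi => (Finset.mem_sort _).2
            (Finset.subset_union_right (Finset.mem_biUnion.2 ⟨p, hp, (Finset.mem_sort _).1 hi⟩)))
          (Finset.sortedGT_sort _).sortedGE (Finset.sortedGT_sort _).sortedGE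
      refine Big.sublist h.nonempty hsub (Finset.sort_nodup _ _) ?_ (hy.mono fun v hv =>
        ⟨hv.1, fun γ hγ => hv.2 γ (Finset.mem_biUnion.2 ⟨p, hp, hγ⟩)⟩)
      intro i _ hi v x
      rw [Finset.mem_sort] at hi
      rw [hE β y i fun h => hi (p.2.2 h)]
      refine and_congr_right fun _ => forall₂_congr fun γ hγ => ?_
      exact hE γ _ i (fun h => hi (p.2.1 γ hγ h)) v x)
    exact ⟨y, fun F t hF ht => hy ⟨(F, t), hF, ht⟩⟩)
  exact ⟨a, fun F t hF => of_max a F (fun γ _ => ha γ) t hF⟩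

/-- The ultrafilter `U` on the `I`-sequences decides each formula uniformly for all bounded
parameters, on sets that are big along every finite set of variables. -/
def Decides (s : L.Relations 2) {I : Type*} [LinearOrder I] (U : Ultrafilter (I → M)) (m₀ : M) :
    Prop :=
  ∀ (t : Finset I) (m : ℕ) (φ : L.Formula (t ⊕ Fin m)) (x : M), ∃ X ∈ U,
    Big (Lt s) (t.sort (· ≥ ·)) (· ∈ X) (fun _ => m₀) ∧ ∀ v ∈ X, ∀ v' ∈ X, ∀ c : Fin m → M,
      (∀ p, Lt s (c p) x) →
        (φ.Realize (Sum.elim (fun i : t => v i) c) ↔ φ.Realize (Sum.elim (fun i : t => v' i) c))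

/-- The tasks are quadruples: variables, number of parameters, code of a formula, and a bound from
the cofinal family `z`. There are at most `κ` of them because the formulas are countable in number.
-/
theorem exists_decides [Countable L.Symbols] {s : L.Relations 2} (h : InaccessibleOrder s M)
    {κ : Cardinal.{w}} (hκ : κ.IsRegular) (hsat : IsSaturated L M κ) {I J : Type w}
    [LinearOrder I] (hI : #I ≤ κ) (hJ : #J ≤ κ) (z : J → M) (hz : ∀ x, ∃ j, Lt s x (z j))
    (m₀ : M) : ∃ U : Ultrafilter (I → M), Decides s U m₀ := by
  classical
  have hκ' := hκ.aleph0_le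
  have hcard : #(Finset I × ℕ × ℕ × J) ≤ κ := by
    have hF : #(Finset I) ≤ κ := by
      rcases finite_or_infinite I with hfin | hinf
      · exact (lt_aleph0_of_finite _).le.trans hκ'
      · rwa [mk_finset_of_infinite]
    have hN : Cardinal.lift.{w} #ℕ ≤ κ := by simpa using hκ'
    have : #(Finset I × ℕ × ℕ × J) =
        #(Finset I) * (Cardinal.lift.{w} #ℕ * (Cardinal.lift.{w} #ℕ * #J)) := by simp
    rw [this]
    exact mul_le_of_le hκ' hF (mul_le_of_le hκ' hN (mul_le_of_le hκ' hN hJ))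
  -- A well-order of least possible type has proper initial segments of size less than `κ`.
  obtain ⟨_, _, hord⟩ := exists_ord_eq_type_lt (Finset I × ℕ × ℕ × J)
  have hsurj : ∀ (t : Finset I) (m : ℕ), ∃ e : ℕ → L.Formula (t ⊕ Fin m), Surjective e :=
    fun t m => exists_surjective_nat _
  choose e he using hsurj
  obtain ⟨a, ha⟩ := exists_coherent h hκ hsat (I := I) (B := Finset I × ℕ × ℕ × J)
    (fun β => (mk_Iio_lt β hord).trans_le hcard) (fun β => β.1)
    (fun β y v => ∀ c : Fin β.2.1 → M, (∀ p, Lt s (c p) (z β.2.2.2)) →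
      ((e β.1 β.2.1 β.2.2.1).Realize (Sum.elim (fun i => v i) c) ↔
        (e β.1 β.2.1 β.2.2.1).Realize (Sum.elim y c)))
    (fun β y i hi v x => by
      have : (fun j : β.1 => update v i x j) = fun j : β.1 => v j := by
        funext j
        exact update_of_ne (fun hj => hi (by rw [← hj]; exact j.2)) _ _
      rw [this]) (fun β => z β.2.2.2) (fun β => by
      refine Dfn.all (P := fun (w : β.1 ⊕ I → M) (c : Fin β.2.1 → M) =>
        (∀ p, Lt s (c p) (z β.2.2.2)) →
        ((e β.1 β.2.1 β.2.2.1).Realize (Sum.elim (fun i => (w ∘ Sum.inr) i) c) ↔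
          (e β.1 β.2.1 β.2.2.1).Realize (Sum.elim (w ∘ Sum.inl) c))) (Dfn.imp
          (Dfn.fintype_all fun p => ?_) (Dfn.iff ?_ ?_))
      · refine (Dfn.lt s _ (0 : Fin 2) 1).comp (fun w : (β.1 ⊕ I) ⊕ Fin β.2.1 → M =>
          ![w (Sum.inr p), z β.2.2.2]) fun i => ?_
        fin_cases i
        · exact Or.inl ⟨_, fun _ => rfl⟩
        · exact Or.inr ⟨_, rfl, fun _ => rfl⟩
      · refine (Dfn.of_formula _ (e β.1 β.2.1 β.2.2.1)).comp
          (fun w : (β.1 ⊕ I) ⊕ Fin β.2.1 → M =>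
            Sum.elim (fun i => w (Sum.inl (Sum.inr i))) (w ∘ Sum.inr)) ?_
        rintro (i | i) <;> exact Or.inl ⟨_, fun _ => rfl⟩
      · refine (Dfn.of_formula _ (e β.1 β.2.1 β.2.2.1)).comp
          (fun w : (β.1 ⊕ I) ⊕ Fin β.2.1 → M =>
            Sum.elim (fun i => w (Sum.inl (Sum.inl i))) (w ∘ Sum.inr)) ?_
        rintro (i | i) <;> exact Or.inl ⟨_, fun _ => rfl⟩)
    (fun β => by
      obtain ⟨z₁, -, H⟩ := h.scheme_tuple (e β.1 β.2.1 β.2.2.1) (z β.2.2.2)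
      exact ⟨z₁, fun v => H _⟩) m₀
  set E : (Finset I × ℕ × ℕ × J) → Set (I → M) := fun β => {v | ∀ c : Fin β.2.1 → M,
    (∀ p, Lt s (c p) (z β.2.2.2)) →
      ((e β.1 β.2.1 β.2.2.1).Realize (Sum.elim (fun i => v i) c) ↔
        (e β.1 β.2.1 β.2.2.1).Realize (Sum.elim (a β) c))} with hE
  -- Big sets are nonempty, so the chosen classes have the finite intersection property.
  obtain ⟨U, hU⟩ := Ultrafilter.exists_ultrafilter_of_finite_inter_nonempty (Set.range E) (by
    intro T hT
    have : ∀ X : T, ∃ β, E β = X := fun X => hT X.2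
    choose g hg using this
    obtain ⟨v, hv⟩ := (ha (Finset.univ.image g) ((Finset.univ.image g).biUnion fun β => β.1)
      fun β hβ => Finset.subset_biUnion_of_mem (fun β => β.1) hβ).exists_of h.nonempty
    refine ⟨v, fun X hX => ?_⟩
    rw [← show E (g ⟨X, hX⟩) = X from hg ⟨X, hX⟩]
    exact hv _ (Finset.mem_image_of_mem _ (Finset.mem_univ _)))
  refine ⟨U, fun t m φ x => ?_⟩
  obtain ⟨k, rfl⟩ := he t m φ
  obtain ⟨j, hj⟩ := hz x
  refine ⟨E (t, m, k, j), hU ⟨_, rfl⟩, (ha {(t, m, k, j)} t (by simp)).mono fun v hv =>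
    hv _ (Finset.mem_singleton_self _), fun v hv v' hv' c hc => ?_⟩
  have hc' : ∀ p, Lt s (c p) (z j) := fun p => h.trans (hc p) hj
  exact (hv c hc').trans (hv' c hc').symm

/-! ### Terms in the coordinates: constancy below `M` and domination by later coordinates -/

namespace Decides

variable {s : L.Relations 2} {I : Type*} [LinearOrder I] {U : Ultrafilter (I → M)} {m₀ : M}
  (hU : Decides s U m₀) (h : InaccessibleOrder s M)
include hU

theorem exists_set (t : Finset I) {P : Type*} [Finite P] (φ : L.Formula (t ⊕ P)) (x : M) :
    ∃ X ∈ U, Big (Lt s) (t.sort (· ≥ ·)) (· ∈ X) (fun _ => m₀) ∧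
      ∀ v ∈ X, ∀ v' ∈ X, ∀ c : P → M, (∀ p, Lt s (c p) x) →
        (φ.Realize (Sum.elim (fun i : t => v i) c) ↔
          φ.Realize (Sum.elim (fun i : t => v' i) c)) := by
  obtain ⟨m, ⟨f⟩⟩ := Finite.exists_equiv_fin P
  obtain ⟨X, hX, hbig, H⟩ := hU t m (φ.relabel (Sum.map id f)) x
  refine ⟨X, hX, hbig, fun v hv v' hv' c hc => ?_⟩
  have := H v hv v' hv' (c ∘ f.symm) fun p => hc _
  rw [Formula.realize_relabel, Formula.realize_relabel] at this
  convert this using 3 <;> ext (i | i) <;> simp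

include h

/-- Some value `e` of the term is itself below `d`, hence an admissible parameter. The formula `τ =
e` is decided uniformly, and it holds where `e` was read off. -/
theorem eventually_eq_of_lt {t : Finset I} {P : Type*} [Finite P] (τ : L.Term (t ⊕ P))
    (c : P → M) (d : M) (hd : ∀ᶠ v : I → M in U, Lt s (τ.realize (Sum.elim (fun i : t => v i) c)) d) :
    ∃ e, ∀ᶠ v : I → M in U, τ.realize (Sum.elim (fun i : t => v i) c) = e := by
  classical
  cases nonempty_fintype P
  obtain ⟨x, hx⟩ := h.exists_ub_finset (insert d (Finset.univ.image c))
  obtain ⟨X, hX, -, H⟩ := hU.exists_set t (P := P ⊕ Unit)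
    ((τ.relabel (Sum.map id Sum.inl)).equal (Term.var (Sum.inr (Sum.inr ())))) x
  have hmem := Filter.inter_mem hX hd
  obtain ⟨v₀, hv₀, hlt⟩ := U.nonempty_of_mem hmem
  refine ⟨τ.realize (Sum.elim (fun i : t => v₀ i) c), Filter.mem_of_superset hX fun v hv => ?_⟩
  have := H v₀ hv₀ v hv (Sum.elim c fun _ => τ.realize (Sum.elim (fun i : t => v₀ i) c)) (by
    rintro (p | _)
    · exact hx _ (by simp)
    · exact h.trans hlt (hx d (by simp)))
  rw [Formula.realize_equal, Formula.realize_equal, Term.realize_relabel, Term.realize_relabel,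
    Sum.elim_comp_map, Sum.elim_comp_map, Sum.elim_comp_inl] at this
  exact this.1 rfl

theorem eventually_lt {t : Finset I} {P : Type*} [Finite P] (τ : L.Term (t ⊕ P)) (c : P → M)
    {i : I} (hi : ∀ j ∈ t, j < i) :
    ∀ᶠ v : I → M in U, Lt s (τ.realize (Sum.elim (fun i : t => v i) c)) (v i) := by
  classical
  cases nonempty_fintype P
  have hit : i ∉ t := fun hit => (hi i hit).false
  obtain ⟨x, hx⟩ := h.exists_ub_finset (Finset.univ.image c)
  let ψ : L.Formula ((insert i t : Finset I) ⊕ P) :=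
    ltF s (τ.relabel (Sum.map (fun j : t => ⟨j, Finset.mem_insert_of_mem j.2⟩) id))
      (Term.var (Sum.inl ⟨i, Finset.mem_insert_self i t⟩))
  have hψ : ∀ v : I → M, ψ.Realize (Sum.elim (fun i => v i) c) ↔
      Lt s (τ.realize (Sum.elim (fun i : t => v i) c)) (v i) := by
    intro v
    rw [realize_ltF, Term.realize_relabel, Sum.elim_comp_map]
    rfl
  obtain ⟨X, hX, hbig, H⟩ := hU.exists_set (insert i t) ψ x
  -- As the largest index, `i` heads the list and is quantified innermost: with the other
  -- coordinates fixed, `v i` can be taken above the value of `τ`. One such point decides the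
  -- formula on all of `X`.
  rw [Finset.sort_insert (r := (· ≥ ·)) (fun j hj => (hi j hj).le) hit] at hbig
  obtain ⟨v', hv'⟩ := Big.exists_of h.nonempty (l := t.sort (· ≥ ·)) hbig
  obtain ⟨y, hy, hyX⟩ := hv' (τ.realize (Sum.elim (fun i : t => v' i) c))
  refine Filter.mem_of_superset hX fun v hv => ?_
  have := H _ hyX v hv c fun p => hx _ (by simp)
  rw [hψ, hψ] at this
  refine this.1 ?_
  have hupd : (fun j : t => update v' i y j) = fun j : t => v' j := by
    funext j
    exact update_of_ne (hi j j.2).ne _ _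
  rwa [hupd, update_self]

end Decides

/-! ### Elementary hulls in the ultrapower -/

/-- In a model of a theory with Skolem functions, every substructure is elementary. -/
theorem HasSkolemFunctions.isElementary {T : L.Theory} (hT : HasSkolemFunctions T) {N : Type*}
    [L.Structure N] [Nonempty N] (hN : N ⊨ T) (S : L.Substructure N) : S.IsElementary := by
  refine S.isElementary_of_exists fun n φ x a ha => ?_
  let ψ : L.Formula (Fin n ⊕ Unit) := φ.toFormula.relabel
    (Sum.elim Empty.elim (Fin.snoc (α := fun _ => Fin n ⊕ Unit) Sum.inl (Sum.inr ())))
  have hψ : ∀ (y : Fin n → N) (b : N), ψ.Realize (Sum.elim y fun _ => b) ↔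
      φ.Realize default (Fin.snoc y b : _ → N) := by
    intro y b
    rw [Formula.realize_relabel, BoundedFormula.realize_toFormula]
    refine iff_of_eq (congrArg₂ _ (Subsingleton.elim _ _) ?_)
    funext i
    induction i using Fin.lastCases <;> simp
  -- The Tarski–Vaught witness is the value of a Skolem term, which stays in `S`.
  obtain ⟨τ, hτ⟩ := hT n ψ
  have := hτ.realize_formula N (v := fun i => (x i : N))
  rw [Formula.realize_imp, Formula.realize_iExs] at this
  have := this ⟨fun _ => a, (hψ _ a).2 ha⟩
  rw [Formula.Realize, BoundedFormula.realize_subst] at this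
  have hτS : S.subtype (τ.realize x) = τ.realize fun i => (x i : N) :=
    (HomClass.realize_term S.subtype).symm
  refine ⟨τ.realize x, (hψ _ _).1 ((iff_of_eq (congrArg _ ?_)).mp this)⟩
  ext (i | i)
  · rfl
  · exact hτS.symm

theorem ElementaryEmbedding.lt_iff (s : L.Relations 2) {M N : Type*} [L.Structure M]
    [L.Structure N] (f : M ↪ₑ[L] N) (x y : M) : Lt s (f x) (f y) ↔ Lt s x y := by
  have := f.map_formula (ltF s (Term.var 0) (Term.var 1)) ![x, y]
  rwa [realize_ltF, realize_ltF] at this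

/-- A cofinal sequence of regular length `μ` witnesses cofinality `μ`. -/
theorem hasCof_of_strictMono {N : Type w} {r : N → N → Prop} (hirr : ∀ x, ¬ r x x)
    (htrans : ∀ x y z, r x y → r y z → r x z) {μ : Cardinal.{w}} (hμ : μ.IsRegular)
    (b : μ.ord.ToType → N) (hb : ∀ i j, i < j → r (b i) (b j)) (hcof : ∀ x, ∃ i, r x (b i)) :
    HasCof r μ := by
  refine ⟨hμ, ⟨fun i => b (Ordinal.ToType.mk i), fun i j hij =>
    hb _ _ (Ordinal.ToType.mk.lt_iff_lt.2 hij), fun x => ?_⟩, fun ν ⟨g, hg, hgcof⟩ => ?_⟩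
  · obtain ⟨i, hi⟩ := hcof x
    exact ⟨Ordinal.ToType.mk.symm i, Or.inr (by simpa using hi)⟩
  -- Dominate a cofinal sequence of length `ν < μ` termwise by values `b (k j)`. By regularity the
  -- indices `k j` have a supremum below `μ`, and `b` at that supremum is not dominated.
  · by_contra! hν
    choose k hk using fun j : ν.ord.ToType => hcof (g (Ordinal.ToType.mk.symm j))
    let o : ν.ord.ToType → Ordinal.{w} := fun j => (Ordinal.ToType.mk.symm (k j) : Set.Iio μ.ord)
    have ho : iSup o < μ.ord := Ordinal.iSup_lt_of_lt_cof
      (by rwa [hμ.cof_ord, mk_ord_toType]) fun j => (Ordinal.ToType.mk.symm (k j)).2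
    obtain ⟨j, hj⟩ := hgcof (b (Ordinal.ToType.mk ⟨iSup o, ho⟩))
    obtain ⟨j, rfl⟩ := Ordinal.ToType.mk.symm.surjective j
    have h1 : r (b (Ordinal.ToType.mk ⟨iSup o, ho⟩)) (b (k j)) := by
      rcases hj with hj | hj
      · rw [hj]
        exact hk j
      · exact htrans _ _ _ hj (hk j)
    have h2 : k j ≤ Ordinal.ToType.mk ⟨iSup o, ho⟩ := by
      rw [← Ordinal.ToType.mk.symm_apply_le]
      exact Ordinal.le_iSup o j
    rcases h2.lt_or_eq with h2 | h2
    · exact hirr _ (htrans _ _ _ h1 (hb _ _ h2))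
    · exact hirr _ (h2 ▸ h1)

section Hull

variable {I : Type w} (U : Ultrafilter (I → M))

/-- The class of a function in the ultrapower of `M`. -/
def ultrapowerMk (f : (I → M) → M) : (U : Filter (I → M)).Product fun _ => M :=
  Quotient.mk ((U : Filter (I → M)).productSetoid fun _ => M) f

/-- The generators of the hull in the ultrapower: the coordinate functions and the constants. -/
def hullGen (y : I ⊕ M) : (U : Filter (I → M)).Product fun _ => M :=
  ultrapowerMk U fun v => Sum.elim v id y

variable (L) in
/-- The substructure of the ultrapower generated by the coordinates and the constants. -/
def hull : L.Substructure ((U : Filter (I → M)).Product fun _ => M) :=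
  Substructure.closure L (Set.range (hullGen U))

variable {U}

/-- By Łoś, a term applied to generators is the class of its pointwise values; only finitely many
coordinates and constants occur in it. -/
theorem exists_term_of_mem_hull {x : (U : Filter (I → M)).Product fun _ => M}
    (hx : x ∈ hull L U) : ∃ (t : Finset I) (P : Finset M) (τ : L.Term (t ⊕ P)),
      x = ultrapowerMk U fun v => τ.realize (Sum.elim (fun i : t => v i) fun p : P => (p : M)) := by
  classical
  obtain ⟨σ, rfl⟩ := Substructure.mem_closure_iff_exists_term.1 hx
  choose g hg using fun y : Set.range (hullGen U) => y.2
  let ρ : L.Term (I ⊕ M) := σ.relabel g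
  let t : Finset I := ρ.varFinset.preimage Sum.inl Sum.inl_injective.injOn
  let P : Finset M := ρ.varFinset.preimage Sum.inr Sum.inr_injective.injOn
  have ht : ∀ i, Sum.inl i ∈ ρ.varFinset → i ∈ t := fun i hi => Finset.mem_preimage.2 hi
  have hP : ∀ m, Sum.inr m ∈ ρ.varFinset → m ∈ P := fun i hi => Finset.mem_preimage.2 hi
  refine ⟨t, P, ρ.restrictVar fun y =>
      match y with
      | ⟨Sum.inl i, hi⟩ => Sum.inl ⟨i, ht i hi⟩
      | ⟨Sum.inr m, hm⟩ => Sum.inr ⟨m, hP m hm⟩, ?_⟩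
  have h1 : ∀ v : I → M, (ρ.restrictVar fun y =>
      match y with
      | ⟨Sum.inl i, hi⟩ => Sum.inl ⟨i, ht i hi⟩
      | ⟨Sum.inr m, hm⟩ => Sum.inr ⟨m, hP m hm⟩).realize
        (Sum.elim (fun i : t => v i) fun p : P => (p : M)) = ρ.realize (Sum.elim v id) := by
    intro v
    refine Term.realize_restrictVar _ ?_
    rintro ⟨i | m, h⟩ <;> rfl
  simp only [h1]
  have h2 := Ultraproduct.term_realize_cast (u := U) (fun (y : I ⊕ M) (v : I → M) =>
    Sum.elim v id y) ρ
  refine Eq.trans ?_ h2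
  rw [Term.realize_relabel]
  congr 1
  funext y
  exact (hg y).symm

theorem mem_hull (y : I ⊕ M) : hullGen U y ∈ hull L U :=
  Substructure.subset_closure ⟨y, rfl⟩

theorem mk_hull_le [Countable L.Symbols] [Infinite M] (hI : #I ≤ #M) : #(hull L U) ≤ #M := by
  have hM : ℵ₀ ≤ #M := aleph0_le_mk M
  have h1 := Substructure.lift_card_closure_le (L := L) (s := Set.range (hullGen U))
  have h2 : #(Set.range (hullGen U)) ≤ #M :=
    mk_range_le.trans (by rw [mk_sum]; simpa using add_le_of_le hM hI le_rfl)
  have : Countable (Σ i, L.Functions i) :=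
    (Sum.inl_injective (α := Σ i, L.Functions i) (β := Σ i, L.Relations i)).countable
      (β := L.Symbols)
  rw [← Cardinal.lift_le.{u}]
  refine h1.trans (max_le (by simp) (add_le_of_le (by simp)
    (by simpa using h2) ?_))
  exact (Cardinal.lift_le_aleph0.2 (mk_le_aleph0 (α := Σ i, L.Functions i))).trans (by simp)

/-- Formulas at the images of the elements of `M` are evaluated in `M`. -/
theorem realize_const (M₀ : Nonempty M) {n : ℕ} (φ : L.Formula (Fin n)) (x : Fin n → M) :
    φ.Realize (fun i => hullGen U (Sum.inr (x i))) ↔ φ.Realize x := by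
  have := Ultraproduct.realize_formula_cast (u := U) φ fun i (_ : I → M) => x i
  rw [Filter.eventually_const] at this
  exact this

theorem lt_ultrapowerMk_iff (M₀ : Nonempty M) (s : L.Relations 2) (f g : (I → M) → M) :
    Lt s (ultrapowerMk U f) (ultrapowerMk U g) ↔
      ∀ᶠ v : I → M in U, Lt s (f v) (g v) := by
  have := Ultraproduct.realize_formula_cast (u := U) (ltF s (Term.var 0) (Term.var 1)) ![f, g]
  simp only [realize_ltF] at this
  exact this

end Hull

/-! ### Assembly of the end extension -/

theorem inaccessibleOrder_of_model {s : L.Relations 2} {T : L.Theory}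
    (horder : ∀ σ ∈ strictLinearOrderTheory s, T ⊨ᵇ σ) (hscheme : InaccessibilityScheme s T)
    (hM : M ⊨ T) (hne : Nonempty M) (hgt : ∀ x : M, ∃ y, Lt s x y) : InaccessibleOrder s M := by
  obtain ⟨h1, h2, h3⟩ := (model_strictLinearOrderTheory s M).1
    (FirstOrder.Language.Theory.model_iff _ |>.2 fun σ hσ => (horder σ hσ).realize_sentence M)
  exact ⟨h1, h2 _ _ _, h3, hgt, hne, fun k m φ =>
    (realize_inaccessibilitySentence s φ M).1 ((hscheme k m φ).realize_sentence M)⟩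

end EndExt

theorem theorem1p3 {L : FirstOrder.Language.{u, v}} [Countable L.Symbols] (lt : L.Relations 2)
    (T : L.Theory) (hcomplete : T.IsComplete)
    (horder : ∀ σ ∈ EndExt.strictLinearOrderTheory lt, T ⊨ᵇ σ)
    (hskolem : EndExt.HasSkolemFunctions T)
    (hscheme : EndExt.InaccessibilityScheme lt T)
    (M : Type w) [L.Structure M] (hM : M ⊨ T) (κ : Cardinal.{w})
    (hcof : EndExt.HasCof (EndExt.Lt lt (M := M)) κ)
    (hsat : EndExt.IsSaturated L M κ)
    (μ : Cardinal.{w}) (hμ : μ.IsRegular) (hμκ : μ ≤ κ) :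
    ∃ (N : Type w) (_ : L.Structure N) (f : M ↪ₑ[L] N),
      EndExt.IsProperEndExtension lt f ∧ #N = #M ∧ EndExt.HasCof (EndExt.Lt lt (M := N)) μ := by
  obtain ⟨hκ, ⟨z, hz, hzcof⟩, -⟩ := hcof
  have hlim : ∀ {ν : Cardinal.{w}}, ν.IsRegular → NoMaxOrder ν.ord.ToType := fun hν =>
    Cardinal.noMaxOrder hν.aleph0_le
  have := hlim hκ
  have := hlim hμ
  have hne : ∀ {ν : Cardinal.{w}}, ν.IsRegular → Nonempty ν.ord.ToType := fun hν => by
    rw [← Cardinal.mk_ne_zero_iff, Cardinal.mk_ord_toType]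
    exact hν.ne_zero
  have hκne := hne hκ
  have := hne hμ
  have hMne : Nonempty M := hκne.map fun j => z (Ordinal.ToType.mk.symm j)
  have hlinear := (EndExt.model_strictLinearOrderTheory lt M).1
    ((FirstOrder.Language.Theory.model_iff _).2 fun σ hσ => (horder σ hσ).realize_sentence M)
  have hz' : ∀ x, ∃ j : κ.ord.ToType, EndExt.Lt lt x (z (Ordinal.ToType.mk.symm j)) := by
    intro x
    obtain ⟨i, hi⟩ := hzcof x
    obtain ⟨i, rfl⟩ := Ordinal.ToType.mk.symm.surjective i
    obtain ⟨j, hij⟩ := exists_gt i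
    have hlt := hz _ _ (Ordinal.ToType.mk.symm.lt_iff_lt.2 hij)
    rcases hi with rfl | hi
    · exact ⟨j, hlt⟩
    · exact ⟨j, hlinear.2.1 _ _ _ hi hlt⟩
  have hgt : ∀ x : M, ∃ y, EndExt.Lt lt x y := fun x => (hz' x).imp' _ fun _ h => h
  have h := EndExt.inaccessibleOrder_of_model horder hscheme hM hMne hgt
  -- This makes the index set, of size `μ ≤ κ`, small enough for the hull to have size `#M`.
  have hκM : κ ≤ #M := by
    have hinj : Function.Injective fun j : κ.ord.ToType => z (Ordinal.ToType.mk.symm j) := by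
      intro i j hij
      by_contra hne
      wlog hlt : i < j generalizing i j
      · exact this hij.symm (Ne.symm hne) ((not_lt.1 hlt).lt_of_ne' hne)
      have hlt' := hz _ _ (Ordinal.ToType.mk.symm.lt_iff_lt.2 hlt)
      exact h.irrefl _ ((congrArg (EndExt.Lt lt · _) hij).mp hlt')
    simpa using Cardinal.mk_le_of_injective hinj
  have : Infinite M := Cardinal.infinite_iff.2 (hκ.aleph0_le.trans hκM)
  obtain ⟨U, hU⟩ := EndExt.exists_decides h hκ hsat (I := μ.ord.ToType) (J := κ.ord.ToType)
    (by simpa using hμκ) (by simp) _ hz' hMne.some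
  have hNstar : ((U : Filter (μ.ord.ToType → M)).Product fun _ => M) ⊨ T := by
    refine (FirstOrder.Language.Theory.model_iff _).2 fun σ hσ => ?_
    rw [FirstOrder.Language.Ultraproduct.sentence_realize]
    exact Filter.Eventually.of_forall fun _ => hM.realize_of_mem σ hσ
  let S : L.ElementarySubstructure ((U : Filter (μ.ord.ToType → M)).Product fun _ => M) :=
    ⟨EndExt.hull L U, hskolem.isElementary hNstar _⟩
  have hS : S ⊨ T := (S.theory_model_iff T).2 hNstar
  have hSlt : ∀ x y : S, EndExt.Lt lt x y ↔ EndExt.Lt lt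
      (x : (U : Filter (μ.ord.ToType → M)).Product fun _ => M) y := fun x y =>
    (EndExt.ElementaryEmbedding.lt_iff lt S.subtype x y).symm
  obtain ⟨hirr, htrans, -⟩ := (EndExt.model_strictLinearOrderTheory lt S).1
    ((FirstOrder.Language.Theory.model_iff _).2 fun σ hσ => (horder σ hσ).realize_sentence S)
  let f : M ↪ₑ[L] S :=
    { toFun := fun m => ⟨EndExt.hullGen U (Sum.inr m), EndExt.mem_hull _⟩
      map_formula' := fun n φ x =>
        (S.subtype.map_formula φ _).symm.trans (EndExt.realize_const hMne φ x) }
  let b : μ.ord.ToType → S := fun i => ⟨EndExt.hullGen U (Sum.inl i), EndExt.mem_hull _⟩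
  have hfb : ∀ m i, EndExt.Lt lt (f m) (b i) := by
    intro m i
    rw [hSlt]
    refine (EndExt.lt_ultrapowerMk_iff hMne lt (fun _ => m) fun v => v i).2 ?_
    -- A constant is a term in no coordinates, so every coordinate lies above it.
    exact hU.eventually_lt h (t := ∅) (P := Unit) (FirstOrder.Language.Term.var (Sum.inr ())) (fun _ => m) (by simp)
  have hbb : ∀ i j, i < j → EndExt.Lt lt (b i) (b j) := by
    intro i j hij
    rw [hSlt]
    refine (EndExt.lt_ultrapowerMk_iff hMne lt (fun v => v i) fun v => v j).2 ?_
    exact hU.eventually_lt h (t := {i}) (P := Empty) (FirstOrder.Language.Term.var (Sum.inl ⟨i, by simp⟩)) Empty.elim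
      (by simpa using hij)
  have hbcof : ∀ x : S, ∃ i, EndExt.Lt lt x (b i) := by
    rintro ⟨x, hx⟩
    obtain ⟨t, P, τ, rfl⟩ := EndExt.exists_term_of_mem_hull hx
    -- `μ.ord` is a limit, so some coordinate comes after the finitely many used by `τ`.
    obtain ⟨i, hi⟩ : ∃ i, ∀ j ∈ t, j < i := by
      obtain ⟨k, hk⟩ := t.exists_le
      obtain ⟨i, hi⟩ := exists_gt k
      exact ⟨i, fun j hj => (hk j hj).trans_lt hi⟩
    refine ⟨i, ?_⟩
    rw [hSlt]
    exact (EndExt.lt_ultrapowerMk_iff hMne lt _ fun v => v i).2 (hU.eventually_lt h τ _ hi)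
  refine ⟨S, inferInstance, f, ⟨?_, ?_⟩, le_antisymm ?_ ?_,
    EndExt.hasCof_of_strictMono hirr htrans hμ b hbb hbcof⟩
  · obtain ⟨i, -⟩ := hbcof (f hMne.some)
    refine ⟨b i, ?_⟩
    rintro ⟨m, hm⟩
    exact hirr _ (hm ▸ hfb m i)
  · rintro a ⟨x, hx⟩ hlt
    obtain ⟨t, P, τ, rfl⟩ := EndExt.exists_term_of_mem_hull hx
    rw [hSlt] at hlt
    -- An element of the hull below `a` is eventually constant, hence the image of its constant
    -- value.
    obtain ⟨e, he⟩ := hU.eventually_eq_of_lt h τ _ a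
      ((EndExt.lt_ultrapowerMk_iff hMne lt _ fun _ => a).1 hlt)
    refine ⟨e, Subtype.ext (Quotient.sound ?_)⟩
    exact he.mono fun v hv => hv.symm
  · exact EndExt.mk_hull_le ((by simpa using hμκ : #μ.ord.ToType ≤ κ).trans hκM)
  · exact Cardinal.mk_le_of_injective f.injective
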